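/- **Setting.** A timed automaton $A=(L,l_0,E,I)$ over a finite set of clocks $C$ and a finite set of actions $Act$ has finitely many locations, a finite set of edges $l\xrightarrow{g,a,r}l'$, and invariants $I(l)$; guards $g$ and invariants are finite conjunctions of constraints $x\smile c$ with $x\in C$, $c\in\mathbb N$, $\smile\,\in\{\le,<,=,>,\ge\}$. Its timed transition system $T(A)$ has as states the pairs $(l,v)$ with $v:C\to\mathbb R_{\ge0}$ and $v\models I(l)$; $(l,v)\xrightarrow{a}(l',v[r])$ if there is an edge $l\xrightarrow{g,a,r}l'$ with $v\models g$ and $v[r]\models I(l')$; and $(l,v)\xrightarrow{d}(l,v+d)$ for $d\in\mathbb R_{\ge0}$ if $v+d\models I(l)$. A relation $R\subseteq T(A_1)\times T(A_2)$ is a *time abstracted simulation* if $p\,R\,q$ implies: for every action $a$ and $p\xrightarrow{a}p'$ there is $q\xrightarrow{a}q'$ with $p'Rq'$; and for every delay $d$ and $p\xrightarrow{d}p'$ there are $d'\in\mathbb R_{\ge0}$ and $q\xrightarrow{d'}q'$ with $p'Rq'$. States $p\in T(A_1)$ and $q\in T(A_2)$ are *time abstracted simulation equivalent* if some time abstracted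 simulation relates $p$ to $q$ and some time abstracted simulation relates $q$ to $p$. *Time abstracted bisimilarity* $\sim_u$ on $T(A)$ is the largest symmetric time abstracted simulation. A zone is a finite union of sets of valuations, each defined by a finite conjunction of constraints $x\smile c$, $x-y\smile c$ with $c\in\mathbb N$. A *zone valuation graph* $Z_{(A,r)}$ of a state $r\in T(A)$ has a finite set $S$ of nodes, each node $s$ being given by a zone for each location (possibly empty; the locations with a non-empty zone form the location set of $s$), with an initial node $s_r$, such that (i) all zones are convex; (ii) $r$ lies in $s_r$; (iii) any two states of $T(A)$ lying in the same node are time abstracted bisimilar; (iv) every state reachable from $r$ lies in some node; (v) every node is reachable from $s_r$ in the graph. Its transitions are labelled by $Lep=Act\cup\{\varepsilon\}$: writing $\mathcal G(s)$ for the set of states reachable from $r$ that lie in $s$, there is a transition $s\xrightarrow{a}s'$ if some state in $\mathcal G(s)$ has an $a$-transition to some state in $\mathcal G(s')$, and $\xrightarrow{\varepsilon}$ is the reflexive transitive closure of the relation "some state in $\mathcal G(s)$ has a delay transition to some state in $\mathcal G(s')$". It is *minimal* if no zone valuation graph of $r$ has fewer nodes. The game $0\text{-}\Gamma^{Z,\langle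 a,a\rangle}_\infty$ is played for infinitely many rounds on zone valuation graphs $Z_1$ of $p$ and $Z_2$ of $q$, starting from the two initial nodes. In each round the attacker chooses one of the graphs, a label $a\in Lep$ and an $a$-transition from the current node of that graph; the defender must answer with an $a$-transition from the current node of the other graph. The attacker may choose either graph in the first round, but must then choose the same graph in all rounds ($0$ alternations). The defender loses if she cannot answer some move, and wins otherwise. **Lemma (Time Abstracted Simulation Equivalence Game).** Let $A_1$, $A_2$ be timed automata over the same set of actions and $p\in T(A_1)$, $q\in T(A_2)$. Then $p$ and $q$ have minimal zone valuation graphs, and for all zone valuation graphs $Z_1$ of $p$ and $Z_2$ of $q$ (minimal or not), the defender has a winning strategy in the game $0\text{-}\Gamma^{Z,\langle a,a\rangle}_\infty$ on $Z_1$ and $Z_2$ if and only if $p$ and $q$ are time abstracted simulation equivalent. -/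

import Mathlib

open scoped NNReal

namespace TimedGames

/-! ### Timed automata and their timed labelled transition systems -/

/-- The comparison symbols `≤, <, =, >, ≥`. -/
inductive Cmp
  | le
  | lt
  | eq
  | gt
  | ge

/-- Meaning of a comparison symbol on real numbers. -/
def Cmp.Holds : Cmp → ℝ → ℝ → Prop
  | .le, a, b => a ≤ b
  | .lt, a, b => a < b
  | .eq, a, b => a = b
  | .gt, a, b => a > b
  | .ge, a, b => a ≥ b

/-- Clock valuations. -/
abbrev Valuation (C : Type*) := C → ℝ≥0

/-- Clock constraints `g ::= x ⌣ c | g ∧ g` with `c ∈ ℕ`. -/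
inductive ClockConstraint (C : Type*)
  | atom (x : C) (r : Cmp) (c : ℕ)
  | and (g h : ClockConstraint C)

/-- `v ⊨ g`. -/
def ClockConstraint.Sat {C : Type*} (v : Valuation C) : ClockConstraint C → Prop
  | .atom x r c => r.Holds (v x : ℝ) (c : ℝ)
  | .and g h => g.Sat v ∧ h.Sat v

/-- An edge `l --(g, a, r)--> l'` of a timed automaton. -/
structure Edge (L C Act : Type*) where
  src : L
  guard : ClockConstraint C
  act : Act
  reset : Set C
  tgt : L

/-- A timed automaton `(L, l₀, E, I)` over the clocks `C` and the actions `Act`. -/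
structure TimedAutomaton (L C Act : Type*) where
  start : L
  edges : Set (Edge L C Act)
  edges_finite : edges.Finite
  inv : L → ClockConstraint C

/-- `v + d`. -/
def Valuation.shift {C : Type*} (v : Valuation C) (d : ℝ≥0) : Valuation C :=
  fun x => v x + d

open Classical in
/-- `v[r]`: the clocks in `r` are reset to `0`. -/
noncomputable def Valuation.resetOn {C : Type*} (v : Valuation C) (r : Set C) : Valuation C :=
  fun x => if x ∈ r then 0 else v x

/-- The labels `Act ∪ ℝ≥0` of a timed labelled transition system. -/
inductive Label (Act : Type*)
  | act (a : Act)
  | delay (d : ℝ≥0)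

namespace TimedAutomaton

variable {L C Act : Type*}

/-- The states (timed processes) of `T(A)`: pairs `(l, v)` with `v ⊨ I(l)`. -/
structure State (A : TimedAutomaton L C Act) where
  loc : L
  val : Valuation C
  inv_sat : (A.inv loc).Sat val

/-- The transition relation of `T(A)`. -/
def Step (A : TimedAutomaton L C Act) (p : A.State) : Label Act → A.State → Prop
  | .act a, p' => ∃ e ∈ A.edges, e.src = p.loc ∧ e.act = a ∧ e.tgt = p'.loc ∧
      e.guard.Sat p.val ∧ p'.val = p.val.resetOn e.reset
  | .delay d, p' => p'.loc = p.loc ∧ p'.val = p.val.shift d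

/-- `p'` is reachable from `p` in `T(A)`. -/
def Reachable (A : TimedAutomaton L C Act) : A.State → A.State → Prop :=
  Relation.ReflTransGen fun p p' => ∃ α, A.Step p α p'

/-- `R` is a time abstracted bisimulation: it is symmetric, actions are matched by the same
action and delays are matched by arbitrary delays. -/
def IsTimeAbstractedBisimulation (A : TimedAutomaton L C Act)
    (R : A.State → A.State → Prop) : Prop :=
  (∀ p q, R p q → R q p) ∧
  ∀ p q, R p q →
    (∀ a p', A.Step p (.act a) p' → ∃ q', A.Step q (.act a) q' ∧ R p' q') ∧
    (∀ d p', A.Step p (.delay d) p' → ∃ d' q', A.Step q (.delay d') q' ∧ R p' q')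

/-- Time abstracted bisimilarity `p ∼ᵤ q`: the largest time abstracted bisimulation. -/
def TimeAbstractedBisimilar (A : TimedAutomaton L C Act) (p q : A.State) : Prop :=
  ∃ R, A.IsTimeAbstractedBisimulation R ∧ R p q

end TimedAutomaton

section Simulation

variable {L₁ C₁ L₂ C₂ Act : Type*}

/-- `R` is a time abstracted simulation of states of `A₁` by states of `A₂`. -/
def IsTimeAbstractedSimulation (A₁ : TimedAutomaton L₁ C₁ Act) (A₂ : TimedAutomaton L₂ C₂ Act)
    (R : A₁.State → A₂.State → Prop) : Prop :=
  ∀ p q, R p q →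
    (∀ a p', A₁.Step p (.act a) p' → ∃ q', A₂.Step q (.act a) q' ∧ R p' q') ∧
    (∀ d p', A₁.Step p (.delay d) p' → ∃ d' q', A₂.Step q (.delay d') q' ∧ R p' q')

/-- `q` time abstractedly simulates `p`. -/
def TimeAbstractedSimulates (A₁ : TimedAutomaton L₁ C₁ Act) (A₂ : TimedAutomaton L₂ C₂ Act)
    (p : A₁.State) (q : A₂.State) : Prop :=
  ∃ R, IsTimeAbstractedSimulation A₁ A₂ R ∧ R p q

/-- Time abstracted simulation equivalence: each of the two states simulates the other one. -/
def TimeAbstractedSimulationEquivalent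
    (A₁ : TimedAutomaton L₁ C₁ Act) (A₂ : TimedAutomaton L₂ C₂ Act)
    (p : A₁.State) (q : A₂.State) : Prop :=
  TimeAbstractedSimulates A₁ A₂ p q ∧ TimeAbstractedSimulates A₂ A₁ q p

end Simulation

/-! ### Zones and zone valuation graphs -/

/-- Atomic linear formulas: `x ⌣ c` and diagonal constraints `x - y ⌣ c`. -/
inductive LinearAtom (C : Type*)
  | single (x : C) (r : Cmp) (c : ℕ)
  | diag (x y : C) (r : Cmp) (c : ℕ)

/-- `v ⊨ φ` for an atomic linear formula. -/
def LinearAtom.Sat {C : Type*} (v : Valuation C) : LinearAtom C → Prop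
  | .single x r c => r.Holds (v x : ℝ) (c : ℝ)
  | .diag x y r c => r.Holds ((v x : ℝ) - (v y : ℝ)) (c : ℝ)

/-- A zone, presented as a finite disjunction of finite conjunctions of atomic linear formulas. -/
abbrev Zone (C : Type*) := List (List (LinearAtom C))

/-- The set of valuations described by a zone. -/
def Zone.toSet {C : Type*} (z : Zone C) : Set (Valuation C) :=
  {v | ∃ φ ∈ z, ∀ a ∈ φ, a.Sat v}

/-- The labels `Lep = Act ∪ {ε}` of a zone graph. -/
inductive Lep (Act : Type*)
  | act (a : Act)
  | eps

/-- The nodes of a zone graph. A node `s` carries a zone for each location `l`; its location set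
consists of the `l` whose zone is non-empty. (This is a single location for an ordinary node, and
several locations for a node obtained by merging nodes at different locations.) -/
structure ZoneGraph (L C : Type*) where
  Node : Type
  zone : Node → L → Zone C
  root : Node

namespace ZoneGraph

variable {L C Act : Type*}

/-- The state `p` lies in the node `s`. -/
def Mem (Z : ZoneGraph L C) (A : TimedAutomaton L C Act) (s : Z.Node) (p : A.State) : Prop :=
  p.val ∈ (Z.zone s p.loc).toSet

/-- `𝒢(s)`: the states reachable from `r` that lie in the node `s`. -/
def states (Z : ZoneGraph L C) (A : TimedAutomaton L C Act) (r : A.State) (s : Z.Node) :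
    Set A.State :=
  {p | A.Reachable r p ∧ Z.Mem A s p}

/-- Some state of `𝒢(s)` has an `α`-transition to some state of `𝒢(s')`. -/
def OneStep (Z : ZoneGraph L C) (A : TimedAutomaton L C Act) (r : A.State)
    (s : Z.Node) (α : Label Act) (s' : Z.Node) : Prop :=
  ∃ p ∈ Z.states A r s, ∃ p' ∈ Z.states A r s', A.Step p α p'

/-- The transitions of the zone graph. Action transitions are those induced by the states in the
nodes; `ε`-transitions are induced by delays and are reflexive and transitive. -/
def Trans (Z : ZoneGraph L C) (A : TimedAutomaton L C Act) (r : A.State) (s : Z.Node) :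
    Lep Act → Z.Node → Prop
  | .act a, s' => Z.OneStep A r s (.act a) s'
  | .eps, s' => Relation.ReflTransGen (fun t t' => ∃ d, Z.OneStep A r t (.delay d) t') s s'

/-- `Z` is a zone valuation graph of the state `r` of `A` (minimality is a separate predicate). -/
structure IsZoneValuationGraph (Z : ZoneGraph L C) (A : TimedAutomaton L C Act)
    (r : A.State) : Prop where
  /-- There are finitely many nodes. -/
  finite : Finite Z.Node
  /-- All zones are convex. -/
  convex : ∀ s l, Convex ℝ≥0 (Z.zone s l).toSet
  /-- `r` lies in the initial node. -/
  root_mem : Z.Mem A Z.root r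
  /-- States in the same node are time abstracted bisimilar. -/
  bisimilar : ∀ s (p q : A.State), Z.Mem A s p → Z.Mem A s q → A.TimeAbstractedBisimilar p q
  /-- Every state reachable from `r` lies in some node. -/
  cover : ∀ p, A.Reachable r p → ∃ s, Z.Mem A s p
  /-- The graph is connected: all nodes are reachable from the initial node. -/
  connected : ∀ s, Relation.ReflTransGen (fun t t' => ∃ α, Z.Trans A r t α t') Z.root s

/-- `Z` has the least possible number of nodes among the zone valuation graphs of `r`. -/
def IsMinimal (Z : ZoneGraph L C) (A : TimedAutomaton L C Act) (r : A.State) : Prop :=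
  ∀ Z' : ZoneGraph L C, Z'.IsZoneValuationGraph A r → Nat.card Z.Node ≤ Nat.card Z'.Node

end ZoneGraph

/-! ### The games -/

/-- The two graphs on which a game is played. -/
inductive Side
  | left
  | right
  deriving DecidableEq

/-- The number of alternations in a sequence of choices of graphs: the number of pairs of
consecutive rounds in which different graphs are chosen. -/
def alternations : List Side → ℕ
  | a :: b :: l => (if a = b then 0 else 1) + alternations (b :: l)
  | _ => 0

/-- A completed round: the graph chosen by the attacker, the label of the two moves, and the pair
of nodes after the round. -/
structure Round (N₁ N₂ Act : Type*) where
  side : Side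
  label : Lep Act
  pos : N₁ × N₂

section Game

variable {N₁ N₂ Act : Type*}

/-- The current pair of nodes after a history (most recent round first). -/
def currentPos (start : N₁ × N₂) : List (Round N₁ N₂ Act) → N₁ × N₂
  | [] => start
  | r :: _ => r.pos

/-- A strategy of the defender: given the history and the attacker's move (a label and the new node
in the graph chosen by the attacker), it names a new node in the other graph. -/
structure DefenderStrategy (N₁ N₂ Act : Type*) where
  onLeft : List (Round N₁ N₂ Act) → Lep Act → N₁ → N₂
  onRight : List (Round N₁ N₂ Act) → Lep Act → N₂ → N₁

/-- In a game with at most `n` alternations and `k` rounds, the attacker may, after history `h`,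
play the next round on the graph `i`. -/
def MayChoose (n k : ℕ∞) (h : List (Round N₁ N₂ Act)) (i : Side) : Prop :=
  (h.length : ℕ∞) < k ∧ (alternations (i :: h.map Round.side) : ℕ∞) ≤ n

/-- The histories that can arise when the defender follows `σ`, in the game with at most `n`
alternations and `k` rounds on the graphs `E₁`, `E₂`. -/
inductive ConsistentHistory (n k : ℕ∞) (E₁ : N₁ → Lep Act → N₁ → Prop)
    (E₂ : N₂ → Lep Act → N₂ → Prop) (start : N₁ × N₂) (σ : DefenderStrategy N₁ N₂ Act) :
    List (Round N₁ N₂ Act) → Prop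
  | nil : ConsistentHistory n k E₁ E₂ start σ []
  | left (h : List (Round N₁ N₂ Act)) (a : Lep Act) (x : N₁)
      (hh : ConsistentHistory n k E₁ E₂ start σ h) (hm : MayChoose n k h .left)
      (hx : E₁ (currentPos start h).1 a x) :
      ConsistentHistory n k E₁ E₂ start σ (⟨.left, a, (x, σ.onLeft h a x)⟩ :: h)
  | right (h : List (Round N₁ N₂ Act)) (a : Lep Act) (y : N₂)
      (hh : ConsistentHistory n k E₁ E₂ start σ h) (hm : MayChoose n k h .right)
      (hy : E₂ (currentPos start h).2 a y) :
      ConsistentHistory n k E₁ E₂ start σ (⟨.right, a, (σ.onRight h a y, y)⟩ :: h)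

/-- `σ` is a (universal) winning strategy of the defender: whatever the attacker does, the defender
always answers a move with label `a` by a move with label `a` in the other graph. -/
def DefenderStrategy.IsWinning (n k : ℕ∞) (E₁ : N₁ → Lep Act → N₁ → Prop)
    (E₂ : N₂ → Lep Act → N₂ → Prop) (start : N₁ × N₂) (σ : DefenderStrategy N₁ N₂ Act) : Prop :=
  ∀ h, ConsistentHistory n k E₁ E₂ start σ h →
    (MayChoose n k h .left → ∀ a x, E₁ (currentPos start h).1 a x →
      E₂ (currentPos start h).2 a (σ.onLeft h a x)) ∧
    (MayChoose n k h .right → ∀ a y, E₂ (currentPos start h).2 a y →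
      E₁ (currentPos start h).1 a (σ.onRight h a y))

/-- The defender has a universal winning strategy in the game with at most `n` alternations (`⊤`: no
restriction) and `k` rounds (`⊤`: infinitely many), with moves `⟨a, a⟩` for `a ∈ Lep`. -/
def DefenderWins (n k : ℕ∞) (E₁ : N₁ → Lep Act → N₁ → Prop)
    (E₂ : N₂ → Lep Act → N₂ → Prop) (start : N₁ × N₂) : Prop :=
  ∃ σ : DefenderStrategy N₁ N₂ Act, σ.IsWinning n k E₁ E₂ start

end Game

end TimedGames

namespace TimedGames

/-! ### Time abstracted bisimilarity and similarity -/

namespace TimedAutomaton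

variable {L C Act : Type*} {A : TimedAutomaton L C Act} {p q r : A.State}

/-! With no alternations allowed, a play stays on one graph forever, so the game splits into two
independent simulation games. The defender wins both exactly when each graph simulates the other
(`exists_graphSimulation_left_of_defenderWins`, its mirror image, and
`defenderWins_of_graphSimulations`).

Graph simulations correspond to time abstracted simulations because the states in a node are
bisimilar: a transition of a node is witnessed by one state, and every other state of the node can
imitate it up to bisimilarity. An `ε`-path is a chain of such delays, and consecutive delays add up
to one delay. The two directions are `IsGraphSimulation.of_simulates` and
`TimeAbstractedSimulates.of_graphSimulation`.

Zone valuation graphs exist by the region construction: region equivalence, up to the largest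
constant of the automaton, has finitely many classes, is a bisimulation and has convex zones as
classes. A minimal graph then exists since node counts are natural numbers. -/

theorem Step.reachable {α : Label Act} (hr : A.Reachable r p) (h : A.Step p α q) :
    A.Reachable r q :=
  hr.tail ⟨α, h⟩

theorem step_delay_zero (p : A.State) : A.Step p (.delay 0) p :=
  ⟨rfl, by funext x; simp [Valuation.shift]⟩

theorem Step.delay_trans {d e : ℝ≥0} (h : A.Step p (.delay d) q) (h' : A.Step q (.delay e) r) :
    A.Step p (.delay (d + e)) r := by
  refine ⟨h'.1.trans h.1, ?_⟩
  rw [h'.2, h.2]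
  funext x
  simp [Valuation.shift, add_assoc]

theorem TimeAbstractedBisimilar.symm (h : A.TimeAbstractedBisimilar p q) :
    A.TimeAbstractedBisimilar q p := by
  obtain ⟨R, hR, hpq⟩ := h
  exact ⟨R, hR, hR.1 _ _ hpq⟩

theorem TimeAbstractedBisimilar.act (h : A.TimeAbstractedBisimilar p q) {a : Act} {p' : A.State}
    (hp : A.Step p (.act a) p') :
    ∃ q', A.Step q (.act a) q' ∧ A.TimeAbstractedBisimilar p' q' := by
  obtain ⟨R, hR, hpq⟩ := h
  obtain ⟨q', hq, hq'⟩ := (hR.2 _ _ hpq).1 a p' hp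
  exact ⟨q', hq, R, hR, hq'⟩

theorem TimeAbstractedBisimilar.delay (h : A.TimeAbstractedBisimilar p q) {d : ℝ≥0}
    {p' : A.State} (hp : A.Step p (.delay d) p') :
    ∃ d' q', A.Step q (.delay d') q' ∧ A.TimeAbstractedBisimilar p' q' := by
  obtain ⟨R, hR, hpq⟩ := h
  obtain ⟨d', q', hq, hq'⟩ := (hR.2 _ _ hpq).2 d p' hp
  exact ⟨d', q', hq, R, hR, hq'⟩

theorem TimeAbstractedBisimilar.trans (h : A.TimeAbstractedBisimilar p q)
    (h' : A.TimeAbstractedBisimilar q r) : A.TimeAbstractedBisimilar p r := by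
  refine ⟨fun p r => ∃ q, A.TimeAbstractedBisimilar p q ∧ A.TimeAbstractedBisimilar q r,
    ⟨?_, ?_⟩, q, h, h'⟩
  · rintro p r ⟨q, h, h'⟩
    exact ⟨q, h'.symm, h.symm⟩
  · rintro p r ⟨q, h, h'⟩
    refine ⟨fun a p' hp => ?_, fun d p' hp => ?_⟩
    · obtain ⟨q', hq, hpq⟩ := h.act hp
      obtain ⟨r', hr, hqr⟩ := h'.act hq
      exact ⟨r', hr, q', hpq, hqr⟩
    · obtain ⟨e, q', hq, hpq⟩ := h.delay hp
      obtain ⟨f, r', hr, hqr⟩ := h'.delay hq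
      exact ⟨f, r', hr, q', hpq, hqr⟩

end TimedAutomaton

section Similarity

variable {L₁ C₁ L₂ C₂ Act : Type*} {A₁ : TimedAutomaton L₁ C₁ Act} {A₂ : TimedAutomaton L₂ C₂ Act}
  {p : A₁.State} {q : A₂.State}

theorem TimeAbstractedSimulates.act (h : TimeAbstractedSimulates A₁ A₂ p q) {a : Act}
    {p' : A₁.State} (hp : A₁.Step p (.act a) p') :
    ∃ q', A₂.Step q (.act a) q' ∧ TimeAbstractedSimulates A₁ A₂ p' q' := by
  obtain ⟨R, hR, hpq⟩ := h
  obtain ⟨q', hq, hq'⟩ := (hR _ _ hpq).1 a p' hp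
  exact ⟨q', hq, R, hR, hq'⟩

theorem TimeAbstractedSimulates.delay (h : TimeAbstractedSimulates A₁ A₂ p q) {d : ℝ≥0}
    {p' : A₁.State} (hp : A₁.Step p (.delay d) p') :
    ∃ d' q', A₂.Step q (.delay d') q' ∧ TimeAbstractedSimulates A₁ A₂ p' q' := by
  obtain ⟨R, hR, hpq⟩ := h
  obtain ⟨d', q', hq, hq'⟩ := (hR _ _ hpq).2 d p' hp
  exact ⟨d', q', hq, R, hR, hq'⟩

/-- The composite of bisimilarity with similarity is again a simulation. This lets a state stand in
for any other state of its node. -/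
theorem TimeAbstractedSimulates.of_bisimilar {p₀ : A₁.State}
    (hb : A₁.TimeAbstractedBisimilar p₀ p) (h : TimeAbstractedSimulates A₁ A₂ p q) :
    TimeAbstractedSimulates A₁ A₂ p₀ q := by
  refine ⟨fun p₀ q => ∃ p, A₁.TimeAbstractedBisimilar p₀ p ∧ TimeAbstractedSimulates A₁ A₂ p q,
    ?_, p, hb, h⟩
  rintro p₀ q ⟨p, hb, h⟩
  refine ⟨fun a p' hp => ?_, fun d p' hp => ?_⟩
  · obtain ⟨p₁, hp₁, hb₁⟩ := hb.act hp
    obtain ⟨q', hq, hs⟩ := h.act hp₁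
    exact ⟨q', hq, p₁, hb₁, hs⟩
  · obtain ⟨e, p₁, hp₁, hb₁⟩ := hb.delay hp
    obtain ⟨f, q', hq, hs⟩ := h.delay hp₁
    exact ⟨f, q', hq, p₁, hb₁, hs⟩

end Similarity

/-! ### Simulations of graphs and the game without alternations -/

section GraphSimulation

variable {N₁ N₂ Act : Type*}

/-- `W` is a simulation of the labelled graph `E₁` by the labelled graph `E₂`. -/
def IsGraphSimulation (E₁ : N₁ → Lep Act → N₁ → Prop) (E₂ : N₂ → Lep Act → N₂ → Prop)
    (W : N₁ → N₂ → Prop) : Prop :=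
  ∀ s t, W s t → ∀ a s', E₁ s a s' → ∃ t', E₂ t a t' ∧ W s' t'

variable {E₁ : N₁ → Lep Act → N₁ → Prop} {E₂ : N₂ → Lep Act → N₂ → Prop} {s : N₁} {t : N₂}

theorem alternations_cons_eq_zero {i : Side} {l : List Side} (h : ∀ j ∈ l, j = i) :
    alternations (i :: l) = 0 := by
  induction l with
  | nil => rfl
  | cons j l ih =>
    obtain rfl := h j (by simp)
    simp [alternations, ih fun k hk => h k (by simp [hk])]

theorem eq_of_alternations_cons_eq_zero {i : Side} {l : List Side}
    (h : alternations (i :: l) = 0) : ∀ j ∈ l, j = i := by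
  induction l generalizing i with
  | nil => simp
  | cons j l ih =>
    simp only [alternations, Nat.add_eq_zero_iff, ite_eq_left_iff, one_ne_zero, imp_false,
      not_not] at h
    obtain ⟨rfl, h⟩ := h
    simpa using ih h

theorem mayChoose_zero_top_iff {h : List (Round N₁ N₂ Act)} {i : Side} :
    MayChoose 0 ⊤ h i ↔ ∀ r ∈ h, r.side = i := by
  have : MayChoose 0 ⊤ h i ↔ alternations (i :: h.map Round.side) = 0 := by
    simp [MayChoose]
  rw [this]
  refine ⟨fun h' r hr => eq_of_alternations_cons_eq_zero h' _ (List.mem_map_of_mem hr),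
    fun h' => alternations_cons_eq_zero ?_⟩
  simpa using h'

/-- The positions reached by all-left plays against a winning strategy form a simulation: the
strategy's answer is the matching move, and the play it extends stays all-left. -/
theorem exists_graphSimulation_left_of_defenderWins (h : DefenderWins 0 ⊤ E₁ E₂ (s, t)) :
    ∃ W, IsGraphSimulation E₁ E₂ W ∧ W s t := by
  obtain ⟨σ, hσ⟩ := h
  refine ⟨fun x y => ∃ h, ConsistentHistory 0 ⊤ E₁ E₂ (s, t) σ h ∧
    (∀ r ∈ h, r.side = .left) ∧ currentPos (s, t) h = (x, y), ?_, [], .nil, by simp, rfl⟩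
  rintro x y ⟨h, hh, hl, hp⟩ a x' hx
  have hm := mayChoose_zero_top_iff.2 hl
  have hx' : E₁ (currentPos (s, t) h).1 a x' := by rwa [hp]
  refine ⟨σ.onLeft h a x', ?_, _, .left h a x' hh hm hx', ?_, rfl⟩
  · simpa [hp] using (hσ h hh).1 hm a x' hx'
  · simpa using hl

theorem exists_graphSimulation_right_of_defenderWins (h : DefenderWins 0 ⊤ E₁ E₂ (s, t)) :
    ∃ W, IsGraphSimulation E₂ E₁ W ∧ W t s := by
  obtain ⟨σ, hσ⟩ := h
  refine ⟨fun y x => ∃ h, ConsistentHistory 0 ⊤ E₁ E₂ (s, t) σ h ∧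
    (∀ r ∈ h, r.side = .right) ∧ currentPos (s, t) h = (x, y), ?_, [], .nil, by simp, rfl⟩
  rintro y x ⟨h, hh, hl, hp⟩ a y' hy
  have hm := mayChoose_zero_top_iff.2 hl
  have hy' : E₂ (currentPos (s, t) h).2 a y' := by rwa [hp]
  refine ⟨σ.onRight h a y', ?_, _, .right h a y' hh hm hy', ?_, rfl⟩
  · simpa [hp] using (hσ h hh).2 hm a y' hy'
  · simpa using hl

theorem defenderWins_of_graphSimulations {W : N₁ → N₂ → Prop} {V : N₂ → N₁ → Prop}
    (hW : IsGraphSimulation E₁ E₂ W) (hV : IsGraphSimulation E₂ E₁ V) (hst : W s t)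
    (hts : V t s) : DefenderWins 0 ⊤ E₁ E₂ (s, t) := by
  have hl : ∀ (z : N₁ × N₂) (a : Lep Act) (x : N₁), ∃ y, W z.1 z.2 → E₁ z.1 a x →
      E₂ z.2 a y ∧ W x y := by
    intro z a x
    by_cases h : W z.1 z.2 ∧ E₁ z.1 a x
    · obtain ⟨y, hy⟩ := hW _ _ h.1 a x h.2
      exact ⟨y, fun _ _ => hy⟩
    -- Away from related positions and legal moves the answer is irrelevant; `t` is only a default
    -- that makes the choice function total.
    · exact ⟨t, fun h₁ h₂ => absurd ⟨h₁, h₂⟩ h⟩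
  have hr : ∀ (z : N₁ × N₂) (a : Lep Act) (y : N₂), ∃ x, V z.2 z.1 → E₂ z.2 a y →
      E₁ z.1 a x ∧ V y x := by
    intro z a y
    by_cases h : V z.2 z.1 ∧ E₂ z.2 a y
    · obtain ⟨x, hx⟩ := hV _ _ h.1 a y h.2
      exact ⟨x, fun _ _ => hx⟩
    · exact ⟨s, fun h₁ h₂ => absurd ⟨h₁, h₂⟩ h⟩
  choose f hf using hl
  choose g hg using hr
  let σ : DefenderStrategy N₁ N₂ Act :=
    ⟨fun h a x => f (currentPos (s, t) h) a x, fun h a y => g (currentPos (s, t) h) a y⟩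
  -- Invariant: `W` holds along all-left plays and `V` along all-right ones. The empty history is
  -- both, which is why both simulations are needed at the start.
  have key : ∀ h, ConsistentHistory 0 ⊤ E₁ E₂ (s, t) σ h →
      ((∀ r ∈ h, r.side = .left) → W (currentPos (s, t) h).1 (currentPos (s, t) h).2) ∧
      ((∀ r ∈ h, r.side = .right) → V (currentPos (s, t) h).2 (currentPos (s, t) h).1) := by
    intro h hh
    induction hh with
    | nil => exact ⟨fun _ => hst, fun _ => hts⟩
    | left h a x hh hm hx ih =>
      refine ⟨fun hl => ?_, fun hl => ?_⟩
      · exact (hf _ a x (ih.1 (mayChoose_zero_top_iff.1 hm)) hx).2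
      · simpa using hl _ List.mem_cons_self
    | right h a y hh hm hy ih =>
      refine ⟨fun hl => ?_, fun hl => ?_⟩
      · simpa using hl _ List.mem_cons_self
      · exact (hg _ a y (ih.2 (mayChoose_zero_top_iff.1 hm)) hy).2
  refine ⟨σ, fun h hh => ⟨fun hm a x hx => ?_, fun hm a y hy => ?_⟩⟩
  · exact (hf _ a x ((key h hh).1 (mayChoose_zero_top_iff.1 hm)) hx).1
  · exact (hg _ a y ((key h hh).2 (mayChoose_zero_top_iff.1 hm)) hy).1

end GraphSimulation

/-! ### Simulations of zone valuation graphs -/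

section ZoneSimulation

variable {L₁ C₁ L₂ C₂ Act : Type*} {A₁ : TimedAutomaton L₁ C₁ Act} {A₂ : TimedAutomaton L₂ C₂ Act}
  {p : A₁.State} {q : A₂.State} {Z₁ : ZoneGraph L₁ C₁} {Z₂ : ZoneGraph L₂ C₂}

/-- The state witnessing a move out of `s` need not be the simulated state `p'`, but it is bisimilar
to it, so `q'` can answer. The answer is reachable, hence covered by some node. An `ε`-path is
answered one delay at a time. -/
theorem IsGraphSimulation.of_simulates (h₁ : Z₁.IsZoneValuationGraph A₁ p)
    (h₂ : Z₂.IsZoneValuationGraph A₂ q) :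
    IsGraphSimulation (Z₁.Trans A₁ p) (Z₂.Trans A₂ q) fun s t =>
      ∃ p' ∈ Z₁.states A₁ p s, ∃ q' ∈ Z₂.states A₂ q t, TimeAbstractedSimulates A₁ A₂ p' q' := by
  rintro s t ⟨p', hp', q', hq', hs⟩ a s' hstep
  cases a with
  | act a =>
    obtain ⟨p₁, hp₁, p₂, hp₂, hstep⟩ := hstep
    obtain ⟨q₂, hq₂, hs₂⟩ :=
      (hs.of_bisimilar (h₁.bisimilar s _ _ hp₁.2 hp'.2)).act hstep
    have hr := hq₂.reachable hq'.1
    obtain ⟨t', ht'⟩ := h₂.cover q₂ hr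
    exact ⟨t', ⟨q', hq', q₂, ⟨hr, ht'⟩, hq₂⟩, p₂, hp₂, q₂, ⟨hr, ht'⟩, hs₂⟩
  | eps =>
    induction hstep with
    | refl => exact ⟨t, .refl, p', hp', q', hq', hs⟩
    | @tail s₁ s₂ _ hstep ih =>
      obtain ⟨t₁, ht₁, p₀, hp₀, q₀, hq₀, hs₀⟩ := ih
      obtain ⟨d, p₁, hp₁, p₂, hp₂, hstep⟩ := hstep
      obtain ⟨e, q₂, hq₂, hs₂⟩ :=
        (hs₀.of_bisimilar (h₁.bisimilar s₁ _ _ hp₁.2 hp₀.2)).delay hstep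
      have hr := hq₂.reachable hq₀.1
      obtain ⟨t', ht'⟩ := h₂.cover q₂ hr
      exact ⟨t', Relation.ReflTransGen.tail ht₁ ⟨e, q₀, hq₀, q₂, ⟨hr, ht'⟩, hq₂⟩,
        p₂, hp₂, q₂, ⟨hr, ht'⟩, hs₂⟩

/-- Each link of an `ε`-path may start at a different state of its node. Bisimilarity glues the
links, and the resulting delays sum to one. -/
theorem ZoneGraph.IsZoneValuationGraph.exists_delay_of_trans_eps
    (h : Z₂.IsZoneValuationGraph A₂ q) {t t' : Z₂.Node} (ht : Z₂.Trans A₂ q t .eps t')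
    {q₀ q' : A₂.State} (hq₀ : q₀ ∈ Z₂.states A₂ q t) (hb : A₂.TimeAbstractedBisimilar q' q₀) :
    ∃ d q'' q₁, A₂.Step q' (.delay d) q'' ∧ q₁ ∈ Z₂.states A₂ q t' ∧
      A₂.TimeAbstractedBisimilar q'' q₁ := by
  induction ht with
  | refl => exact ⟨0, q', q₀, TimedAutomaton.step_delay_zero q', hq₀, hb⟩
  | @tail t₁ t₂ _ hstep ih =>
    obtain ⟨d, q'', q₁, hd, hq₁, hb₁⟩ := ih
    obtain ⟨e, x, hx, y, hy, hstep⟩ := hstep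
    obtain ⟨f, z, hz, hbz⟩ := ((h.bisimilar t₁ _ _ hx.2 hq₁.2).trans hb₁.symm).delay hstep
    exact ⟨d + f, z, y, hd.delay_trans hz, hy, hbz.symm⟩

theorem TimeAbstractedSimulates.of_graphSimulation (h₁ : Z₁.IsZoneValuationGraph A₁ p)
    (h₂ : Z₂.IsZoneValuationGraph A₂ q) {W : Z₁.Node → Z₂.Node → Prop}
    (hW : IsGraphSimulation (Z₁.Trans A₁ p) (Z₂.Trans A₂ q) W) (hroot : W Z₁.root Z₂.root) :
    TimeAbstractedSimulates A₁ A₂ p q := by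
  -- `q'` is only required to be bisimilar to a state of `t`: imitating a move into `t'` leads to a
  -- state bisimilar to one in `t'`, which need not lie in `t'` itself.
  refine ⟨fun p' q' => ∃ s t, W s t ∧ p' ∈ Z₁.states A₁ p s ∧
    ∃ q₀ ∈ Z₂.states A₂ q t, A₂.TimeAbstractedBisimilar q' q₀, ?_,
    _, _, hroot, ⟨.refl, h₁.root_mem⟩, q, ⟨.refl, h₂.root_mem⟩,
    h₂.bisimilar _ _ _ h₂.root_mem h₂.root_mem⟩
  rintro p' q' ⟨s, t, hst, hp', q₀, hq₀, hb⟩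
  refine ⟨fun a p'' hstep => ?_, fun d p'' hstep => ?_⟩
  · have hr := hstep.reachable hp'.1
    obtain ⟨s', hs'⟩ := h₁.cover p'' hr
    obtain ⟨t', ⟨x, hx, y, hy, hxy⟩, hst'⟩ :=
      hW s t hst (.act a) s' ⟨p', hp', p'', ⟨hr, hs'⟩, hstep⟩
    obtain ⟨q'', hq'', hbq⟩ := ((h₂.bisimilar t _ _ hx.2 hq₀.2).trans hb.symm).act hxy
    exact ⟨q'', hq'', s', t', hst', ⟨hr, hs'⟩, y, hy, hbq.symm⟩
  · have hr := hstep.reachable hp'.1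
    obtain ⟨s', hs'⟩ := h₁.cover p'' hr
    obtain ⟨t', ht', hst'⟩ :=
      hW s t hst .eps s' (Relation.ReflTransGen.single ⟨d, p', hp', p'', ⟨hr, hs'⟩, hstep⟩)
    obtain ⟨e, q'', q₁, he, hq₁, hb₁⟩ := h₂.exists_delay_of_trans_eps ht' hq₀ hb
    exact ⟨e, q'', he, s', t', hst', ⟨hr, hs'⟩, q₁, hq₁, hb₁⟩

theorem defenderWins_zero_top_iff (h₁ : Z₁.IsZoneValuationGraph A₁ p)
    (h₂ : Z₂.IsZoneValuationGraph A₂ q) :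
    DefenderWins 0 ⊤ (Z₁.Trans A₁ p) (Z₂.Trans A₂ q) (Z₁.root, Z₂.root) ↔
      TimeAbstractedSimulationEquivalent A₁ A₂ p q := by
  refine ⟨fun h => ?_, fun h => ?_⟩
  · obtain ⟨W, hW, hroot⟩ := exists_graphSimulation_left_of_defenderWins h
    obtain ⟨V, hV, hroot'⟩ := exists_graphSimulation_right_of_defenderWins h
    exact ⟨.of_graphSimulation h₁ h₂ hW hroot, .of_graphSimulation h₂ h₁ hV hroot'⟩
  · exact defenderWins_of_graphSimulations (.of_simulates h₁ h₂) (.of_simulates h₂ h₁)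
      ⟨p, ⟨.refl, h₁.root_mem⟩, q, ⟨.refl, h₂.root_mem⟩, h.1⟩
      ⟨q, ⟨.refl, h₂.root_mem⟩, p, ⟨.refl, h₁.root_mem⟩, h.2⟩

end ZoneSimulation

/-! ### Regions -/

section Region

variable {C : Type*}

/-- A valuation extended by a clock that is constantly `0`. -/
def Valuation.extend (v : Valuation C) : Option C → ℝ
  | none => 0
  | some x => v x

/-- Two valuations agree on all constraints `x - y ≤ k`, where `x` and `y` are clocks or `0`, and
`k` is an integer with `|k| ≤ M`. -/
def RegionEquiv (M : ℕ) (v w : Valuation C) : Prop :=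
  ∀ (i j : Option C) (k : ℤ), |k| ≤ M →
    (v.extend i - v.extend j ≤ k ↔ w.extend i - w.extend j ≤ k)

theorem RegionEquiv.symm {M : ℕ} {v w : Valuation C} (h : RegionEquiv M v w) :
    RegionEquiv M w v :=
  fun i j k hk => (h i j k hk).symm

theorem RegionEquiv.le_iff {M : ℕ} {v w : Valuation C} (h : RegionEquiv M v w) (x : C) {c : ℕ}
    (hc : c ≤ M) : (v x : ℝ) ≤ c ↔ (w x : ℝ) ≤ c := by
  simpa [Valuation.extend] using h (some x) none c (by simpa using hc)

theorem RegionEquiv.ge_iff {M : ℕ} {v w : Valuation C} (h : RegionEquiv M v w) (x : C) {c : ℕ}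
    (hc : c ≤ M) : (c : ℝ) ≤ v x ↔ (c : ℝ) ≤ w x := by
  simpa [Valuation.extend] using h none (some x) (-c) (by simpa using hc)

/-- The largest constant of a clock constraint. -/
def ClockConstraint.maxConst : ClockConstraint C → ℕ
  | .atom _ _ c => c
  | .and g h => max g.maxConst h.maxConst

theorem RegionEquiv.sat {M : ℕ} {v w : Valuation C} (h : RegionEquiv M v w)
    {g : ClockConstraint C} (hg : g.maxConst ≤ M) (hv : g.Sat v) : g.Sat w := by
  induction g with
  | atom x r c =>
    have h₁ := h.le_iff x hg
    have h₂ := h.ge_iff x hg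
    cases r <;> simp only [ClockConstraint.Sat, Cmp.Holds, gt_iff_lt, ge_iff_le] at hv ⊢
    · exact h₁.1 hv
    · exact not_le.1 fun h' => not_le.2 hv (h₂.2 h')
    · exact le_antisymm (h₁.1 hv.le) (h₂.1 hv.ge)
    · exact not_le.1 fun h' => not_le.2 hv (h₁.2 h')
    · exact h₂.1 hv
  | and g g' ih ih' =>
    simp only [ClockConstraint.maxConst, max_le_iff] at hg
    exact ⟨ih hg.1 hv.1, ih' hg.2 hv.2⟩

/-- A reset clock behaves like the constant zero clock, so each constraint after the reset is one of
the constraints before it. -/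
theorem RegionEquiv.resetOn {M : ℕ} {v w : Valuation C} (h : RegionEquiv M v w) (r : Set C) :
    RegionEquiv M (v.resetOn r) (w.resetOn r) := by
  classical
  have key : ∀ i : Option C, ∃ j : Option C, ∀ u : Valuation C,
      (u.resetOn r).extend i = u.extend j := by
    rintro (_ | x)
    · exact ⟨none, fun u => rfl⟩
    · by_cases hx : x ∈ r
      · exact ⟨none, fun u => by simp [Valuation.extend, Valuation.resetOn, hx]⟩
      · exact ⟨some x, fun u => by simp [Valuation.extend, Valuation.resetOn, hx]⟩
  intro i j k hk
  obtain ⟨i', hi⟩ := key i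
  obtain ⟨j', hj⟩ := key j
  rw [hi, hi, hj, hj]
  exact h i' j' k hk

/-- Two finite families of reals with the same order type admit corresponding cuts. -/
theorem exists_same_cut {ι : Type*} [Finite ι] {f g : ι → ℝ}
    (hfg : ∀ i j, f i ≤ f j ↔ g i ≤ g j) (d : ℝ) :
    ∃ e : ℝ, ∀ i, (d ≤ f i ↔ e ≤ g i) ∧ (f i ≤ d ↔ g i ≤ e) := by
  classical
  have := Fintype.ofFinite ι
  by_cases hd : ∃ i, f i = d
  · obtain ⟨i, rfl⟩ := hd
    exact ⟨g i, fun j => ⟨hfg i j, hfg j i⟩⟩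
  · push Not at hd
    obtain ⟨e, he, he'⟩ := Order.exists_between_finsets
      ((Finset.univ.filter fun i => f i < d).image g)
      ((Finset.univ.filter fun i => d < f i).image g) (by
        simp only [Finset.mem_image, Finset.mem_filter, Finset.mem_univ, true_and,
          forall_exists_index, and_imp]
        rintro _ i hi rfl _ j hj rfl
        exact not_le.1 fun h' => not_le.2 (hi.trans hj) ((hfg j i).2 h'))
    simp only [Finset.mem_image, Finset.mem_filter, Finset.mem_univ, true_and,
      forall_exists_index, and_imp, forall_apply_eq_imp_iff₂] at he he'
    refine ⟨e, fun i => ?_⟩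
    rcases lt_or_gt_of_ne (hd i) with h | h
    · exact ⟨iff_of_false h.not_ge (he i h).not_ge, iff_of_true h.le (he i h).le⟩
    · exact ⟨iff_of_true h.le (he' i h).le, iff_of_false h.not_ge (he' i h).not_ge⟩

theorem RegionEquiv.exists_shift [Finite C] {M : ℕ} {v w : Valuation C} (h : RegionEquiv M v w)
    (d : ℝ≥0) : ∃ e : ℝ≥0, RegionEquiv M (v.shift d) (w.shift e) := by
  -- The critical delays are the times `k - v x` at which a clock reaches a constant. Region
  -- equivalence says they are ordered alike for `v` and `w`, so `e` can be placed among them as `d`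
  -- is.
  obtain ⟨e, he⟩ := exists_same_cut (ι := Option C × Fin (M + 1))
    (f := fun i => (i.2 : ℕ) - v.extend i.1) (g := fun i => (i.2 : ℕ) - w.extend i.1) (by
      rintro ⟨i, k, hk⟩ ⟨j, l, hl⟩
      have := h j i (l - k) (by rw [abs_le]; omega)
      push_cast at this
      constructor
      · intro h'
        have := this.1 (by simp only at h'; linarith)
        simp only; linarith
      · intro h'
        have := this.2 (by simp only at h'; linarith)
        simp only; linarith) d
  -- The zero clock with constant `0` contributes the critical time `0`.
  have he0 : 0 ≤ e := by
    simpa [Valuation.extend] using (he (none, 0)).2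
  lift e to ℝ≥0 using he0
  refine ⟨e, ?_⟩
  have key : ∀ (x : C) (c : ℕ), c ≤ M →
      ((v x + d : ℝ) ≤ c ↔ (w x + e : ℝ) ≤ c) ∧ ((c : ℝ) ≤ v x + d ↔ (c : ℝ) ≤ w x + e) := by
    intro x c hc
    have h' := he (some x, ⟨c, Nat.lt_succ_of_le hc⟩)
    simp only [Valuation.extend] at h'
    rw [le_sub_iff_add_le', le_sub_iff_add_le', sub_le_iff_le_add', sub_le_iff_le_add'] at h'
    exact h'
  rintro (_ | x) (_ | y) k hk
  · rfl
  · simp only [Valuation.extend, Valuation.shift, NNReal.coe_add, zero_sub]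
    rcases le_or_gt 0 k with hk0 | hk0
    · have : (0 : ℝ) ≤ k := by exact_mod_cast hk0
      exact iff_of_true (by linarith [(v y).coe_nonneg, d.coe_nonneg])
        (by linarith [(w y).coe_nonneg, e.coe_nonneg])
    · obtain ⟨c, rfl⟩ : ∃ c : ℕ, k = -c := ⟨k.natAbs, by omega⟩
      have := (key y c (by simpa using hk)).2
      simpa only [Int.cast_neg, Int.cast_natCast, neg_le_neg_iff] using this
  · simp only [Valuation.extend, Valuation.shift, NNReal.coe_add, sub_zero]
    rcases le_or_gt 0 k with hk0 | hk0
    · obtain ⟨c, rfl⟩ : ∃ c : ℕ, k = c := ⟨k.natAbs, by omega⟩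
      simpa only [Int.cast_natCast] using (key x c (by simpa using hk)).1
    · have : (k : ℝ) < 0 := by exact_mod_cast hk0
      exact iff_of_false (by linarith [(v x).coe_nonneg, d.coe_nonneg])
        (by linarith [(w x).coe_nonneg, e.coe_nonneg])
  · simpa [Valuation.extend, Valuation.shift] using h (some x) (some y) k hk

end Region

/-! ### Region equivalence is a time abstracted bisimulation -/

section RegionBisimulation

variable {L C Act : Type*} {A : TimedAutomaton L C Act} {M : ℕ}

theorem TimedAutomaton.exists_maxConst_le [Finite L] (A : TimedAutomaton L C Act) :
    ∃ M : ℕ, (∀ l, (A.inv l).maxConst ≤ M) ∧ ∀ e ∈ A.edges, e.guard.maxConst ≤ M := by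
  obtain ⟨M₁, h₁⟩ := (Set.finite_range fun l => (A.inv l).maxConst).bddAbove
  obtain ⟨M₂, h₂⟩ := (A.edges_finite.image fun e => e.guard.maxConst).bddAbove
  exact ⟨max M₁ M₂, fun l => (h₁ ⟨l, rfl⟩).trans (le_max_left _ _),
    fun e he => (h₂ ⟨e, he, rfl⟩).trans (le_max_right _ _)⟩

theorem TimedAutomaton.TimeAbstractedBisimilar.of_regionEquiv [Finite C]
    (hinv : ∀ l, (A.inv l).maxConst ≤ M) (hedge : ∀ e ∈ A.edges, e.guard.maxConst ≤ M) {p q : A.State} (hl : p.loc = q.loc)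
    (h : RegionEquiv M p.val q.val) : A.TimeAbstractedBisimilar p q := by
  refine ⟨fun p q => p.loc = q.loc ∧ RegionEquiv M p.val q.val,
    ⟨fun p q h => ⟨h.1.symm, h.2.symm⟩, ?_⟩, hl, h⟩
  rintro p q ⟨hl, h⟩
  refine ⟨?_, ?_⟩
  · rintro a p' ⟨e, he, hsrc, hact, htgt, hg, hv⟩
    have hr : RegionEquiv M p'.val (q.val.resetOn e.reset) := hv ▸ h.resetOn e.reset
    exact ⟨⟨p'.loc, _, hr.sat (hinv _) p'.inv_sat⟩,
      ⟨e, he, hsrc.trans hl, hact, htgt, h.sat (hedge e he) hg, rfl⟩, rfl, hr⟩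
  · rintro d p' ⟨hl', hv⟩
    obtain ⟨d', hd'⟩ := h.exists_shift d
    rw [← hv] at hd'
    exact ⟨d', ⟨p'.loc, _, hd'.sat (hinv _) p'.inv_sat⟩, ⟨hl'.trans hl, rfl⟩, rfl, hd'⟩

end RegionBisimulation

/-! ### Regions as zones -/

section RegionZone

variable {C : Type*}

/-- The constant of an atomic linear formula. -/
def LinearAtom.const : LinearAtom C → ℕ
  | .single _ _ c => c
  | .diag _ _ _ c => c

instance : Finite Cmp :=
  Finite.of_injective (β := Fin 5) (fun | .le => 0 | .lt => 1 | .eq => 2 | .gt => 3 | .ge => 4) (by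
    rintro (_ | _ | _ | _ | _) (_ | _ | _ | _ | _) h <;> first | rfl | simp at h)

theorem LinearAtom.finite_const_le [Finite C] (M : ℕ) :
    {a : LinearAtom C | a.const ≤ M}.Finite := by
  have h₁ := Set.finite_range fun i : C × Cmp × Fin (M + 1) =>
    LinearAtom.single i.1 i.2.1 i.2.2
  have h₂ := Set.finite_range fun i : C × C × Cmp × Fin (M + 1) =>
    LinearAtom.diag i.1 i.2.1 i.2.2.1 i.2.2.2
  refine (h₁.union h₂).subset ?_
  rintro (⟨x, r, c⟩ | ⟨x, y, r, c⟩) hc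
  · exact .inl ⟨(x, r, ⟨c, Nat.lt_succ_of_le hc⟩), rfl⟩
  · exact .inr ⟨(x, y, r, ⟨c, Nat.lt_succ_of_le hc⟩), rfl⟩

/-- The atomic linear formulas with constant at most `M` that hold at `v`. -/
def atomType (M : ℕ) (v : Valuation C) : Set (LinearAtom C) :=
  {a | a.const ≤ M ∧ a.Sat v}

theorem extend_sub_le_of_atomType_subset {M : ℕ} {v w : Valuation C}
    (h : ∀ a ∈ atomType M v, a.Sat w) (i j : Option C) (k : ℤ) (hk : |k| ≤ M)
    (hv : v.extend i - v.extend j ≤ k) : w.extend i - w.extend j ≤ k := by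
  obtain ⟨c, rfl | rfl⟩ := k.eq_nat_or_neg <;>
  have hc : c ≤ M := by simpa using hk
  · simp only [Int.cast_natCast] at hv ⊢
    rcases i with _ | x <;> rcases j with _ | y <;>
      simp only [Valuation.extend, sub_zero, zero_sub] at hv ⊢
    · exact hv
    · linarith [(w y).coe_nonneg, (Nat.cast_nonneg c : (0 : ℝ) ≤ c)]
    · exact h (.single x .le c) ⟨hc, hv⟩
    · exact h (.diag x y .le c) ⟨hc, hv⟩
  · simp only [Int.cast_neg, Int.cast_natCast] at hv ⊢
    rcases i with _ | x <;> rcases j with _ | y <;>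
      simp only [Valuation.extend, sub_zero, zero_sub, neg_le_neg_iff] at hv ⊢
    · exact hv
    · exact h (.single y .ge c) ⟨hc, hv⟩
    -- Here `v x ≤ -c` forces `c = 0` and `v x = 0`, which the atom `x ≤ 0` records.
    · have hx : (v x : ℝ) ≤ (0 : ℕ) := by
        push_cast; linarith [(Nat.cast_nonneg c : (0 : ℝ) ≤ c)]
      have hc0 : (c : ℝ) ≤ 0 := by linarith [(v x).coe_nonneg]
      have : (w x : ℝ) ≤ (0 : ℕ) := h (.single x .le 0) ⟨Nat.zero_le M, hx⟩
      push_cast at this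
      linarith [(Nat.cast_nonneg c : (0 : ℝ) ≤ c)]
    · have : (w y : ℝ) - w x ≥ c :=
        h (.diag y x .ge c) ⟨hc, show (v y : ℝ) - v x ≥ c by linarith⟩
      linarith

theorem extend_sub_lt_of_atomType_subset {M : ℕ} {v w : Valuation C}
    (h : ∀ a ∈ atomType M v, a.Sat w) (i j : Option C) (k : ℤ) (hk : |k| ≤ M)
    (hv : v.extend i - v.extend j < k) : w.extend i - w.extend j < k := by
  obtain ⟨c, rfl | rfl⟩ := k.eq_nat_or_neg <;>
  have hc : c ≤ M := by simpa using hk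
  · simp only [Int.cast_natCast] at hv ⊢
    rcases i with _ | x <;> rcases j with _ | y <;>
      simp only [Valuation.extend, sub_zero, zero_sub] at hv ⊢
    · exact hv
    · rcases c.eq_zero_or_pos with rfl | hc0
      · have : (w y : ℝ) > (0 : ℕ) :=
          h (.single y .gt 0)
            ⟨Nat.zero_le M, show (v y : ℝ) > (0 : ℕ) by push_cast at hv ⊢; linarith⟩
        push_cast at this ⊢
        linarith
      · have : (0 : ℝ) < c := by exact_mod_cast hc0
        linarith [(w y).coe_nonneg]
    · exact h (.single x .lt c) ⟨hc, hv⟩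
    · exact h (.diag x y .lt c) ⟨hc, hv⟩
  · simp only [Int.cast_neg, Int.cast_natCast] at hv ⊢
    rcases i with _ | x <;> rcases j with _ | y <;>
      simp only [Valuation.extend, sub_zero, zero_sub, neg_lt_neg_iff] at hv ⊢
    · exact hv
    · exact h (.single y .gt c) ⟨hc, hv⟩
    · linarith [(v x).coe_nonneg, (Nat.cast_nonneg c : (0 : ℝ) ≤ c)]
    · have : (w y : ℝ) - w x > c :=
        h (.diag y x .gt c) ⟨hc, show (v y : ℝ) - v x > c by linarith⟩
      linarith

/-- One inclusion of atoms suffices because the negation of `i - j ≤ k` is the strict constraint `j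
- i < -k`, which is preserved as well. -/
theorem RegionEquiv.of_atomType_subset {M : ℕ} {v w : Valuation C}
    (h : ∀ a ∈ atomType M v, a.Sat w) : RegionEquiv M v w := by
  refine fun i j k hk => ⟨extend_sub_le_of_atomType_subset h i j k hk, fun hw => ?_⟩
  by_contra hv
  have := extend_sub_lt_of_atomType_subset h j i (-k) (by simpa using hk)
    (by push_cast; linarith)
  push_cast at this
  linarith

theorem Cmp.convex_setOf_holds (r : Cmp) (c : ℝ) : Convex ℝ {t : ℝ | r.Holds t c} := by
  cases r
  · exact convex_Iic c
  · exact convex_Iio c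
  · exact convex_singleton c
  · exact convex_Ioi c
  · exact convex_Ici c

theorem LinearAtom.convex_setOf_sat (a : LinearAtom C) :
    Convex ℝ≥0 {v : Valuation C | a.Sat v} := by
  intro v hv w hw s t _ _ hst
  have hst' : (s : ℝ) + t = 1 := by exact_mod_cast hst
  cases a with
  | single x r c =>
    have := r.convex_setOf_holds c hv hw s.2 t.2 hst'
    simpa [LinearAtom.Sat] using this
  | diag x y r c =>
    have := r.convex_setOf_holds c hv hw s.2 t.2 hst'
    have e : ((s • v + t • w) x : ℝ) - ((s • v + t • w) y : ℝ) =
        (s : ℝ) • ((v x : ℝ) - v y) + (t : ℝ) • ((w x : ℝ) - w y) := by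
      simp; ring
    change r.Holds _ _
    rw [e]
    exact this

theorem Zone.convex_toSet_singleton (φ : List (LinearAtom C)) :
    Convex ℝ≥0 (Zone.toSet [φ]) := by
  have : Zone.toSet [φ] = ⋂ a ∈ φ, {v | a.Sat v} := by ext; simp [Zone.toSet]
  rw [this]
  exact convex_iInter fun a => convex_iInter fun _ => a.convex_setOf_sat

end RegionZone

/-! ### The region graph -/

section RegionGraph

variable {L C Act : Type*} [Finite L] [Finite C]

theorem exists_isZoneValuationGraph (A : TimedAutomaton L C Act) (r : A.State) :
    ∃ Z : ZoneGraph L C, Z.IsZoneValuationGraph A r := by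
  classical
  obtain ⟨M, hinv, hedge⟩ := A.exists_maxConst_le
  have hfin (v : Valuation C) : (atomType M v).Finite :=
    (LinearAtom.finite_const_le M).subset fun a ha => ha.1
  let key : A.State → L × Set (LinearAtom C) := fun p => (p.loc, atomType M p.val)
  have hrange : (Set.range key).Finite :=
    (Set.finite_univ.prod (LinearAtom.finite_const_le M).finite_subsets).subset <| by
      rintro _ ⟨p, rfl⟩
      exact ⟨trivial, fun a ha => ha.1⟩
  let S : Set (L × Set (LinearAtom C)) := key '' {p | A.Reachable r p}
  have hS : Finite S := (hrange.subset (Set.image_subset_range _ _)).to_subtype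
  -- Nodes must live in `Type`, whereas `S` lives in the universes of `L` and `C`; hence the
  -- transport to `Fin n`.
  obtain ⟨n, ⟨e⟩⟩ := Finite.exists_equiv_fin S
  have hrep : ∀ s : Fin n, ∃ p, A.Reachable r p ∧ key p = (e.symm s : L × Set (LinearAtom C)) :=
    fun s => (e.symm s).2
  choose rep hrep hkey using hrep
  let node : ∀ p, A.Reachable r p → Fin n := fun p hp => e ⟨key p, p, hp, rfl⟩
  let Z : ZoneGraph L C :=
    { Node := Fin n
      zone := fun s l => if l = (rep s).loc then [(hfin (rep s).val).toFinset.toList] else []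
      root := node r .refl }
  have hmem (s : Fin n) (p : A.State) :
      Z.Mem A s p ↔ p.loc = (rep s).loc ∧ ∀ a ∈ atomType M (rep s).val, a.Sat p.val := by
    by_cases h : p.loc = (rep s).loc <;> simp [ZoneGraph.Mem, Z, h, Zone.toSet]
  have hnode (p : A.State) (hp : A.Reachable r p) : p ∈ Z.states A r (node p hp) := by
    refine ⟨hp, (hmem _ p).2 ?_⟩
    have h : key (rep (node p hp)) = key p := by simp [hkey, node]
    refine ⟨(congrArg Prod.fst h).symm, fun a ha => ?_⟩
    have h' : atomType M (rep (node p hp)).val = atomType M p.val := congrArg Prod.snd h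
    have ha' : a ∈ atomType M p.val := h' ▸ ha
    exact ha'.2
  have hpath (p : A.State) (hp : A.Reachable r p) :
      Relation.ReflTransGen (fun t t' => ∃ α, Z.Trans A r t α t') Z.root (node p hp) := by
    induction hp with
    | refl => exact .refl
    | @tail p p' hp hstep ih =>
      obtain ⟨α, hα⟩ := hstep
      refine ih.tail ?_
      cases α with
      | act a => exact ⟨.act a, p, hnode p hp, p', hnode p' (hα.reachable hp), hα⟩
      | delay d => exact ⟨.eps, .single ⟨d, p, hnode p hp, p', hnode p' (hα.reachable hp), hα⟩⟩
  refine ⟨Z, inferInstanceAs (Finite (Fin n)), fun s l => ?_, (hnode r .refl).2,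
    fun s p q hp hq => ?_, fun p hp => ⟨_, (hnode p hp).2⟩, fun s => ?_⟩
  · by_cases h : l = (rep s).loc
    · simpa [Z, h] using Zone.convex_toSet_singleton _
    · simpa [Z, h, Zone.toSet] using convex_empty
  · rw [hmem] at hp hq
    exact TimedAutomaton.TimeAbstractedBisimilar.trans
      (.of_regionEquiv hinv hedge hp.1 (RegionEquiv.of_atomType_subset hp.2).symm)
      (.of_regionEquiv hinv hedge hq.1.symm (.of_atomType_subset hq.2))
  -- Every node is the class of a reachable state, so a run to that state projects to a path in the
  -- graph.
  · have h : node (rep s) (hrep s) = s := by simp [node, hkey]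
    exact h ▸ hpath (rep s) (hrep s)

theorem exists_isMinimal_zoneValuationGraph (A : TimedAutomaton L C Act) (r : A.State) :
    ∃ Z : ZoneGraph L C, Z.IsZoneValuationGraph A r ∧ Z.IsMinimal A r := by
  obtain ⟨Z, hZ, hmin⟩ := WellFounded.has_min
    (measure fun Z : ZoneGraph L C => Nat.card Z.Node).wf {Z | Z.IsZoneValuationGraph A r}
    (exists_isZoneValuationGraph A r)
  exact ⟨Z, hZ, fun Z' hZ' => not_lt.1 (hmin Z' hZ')⟩

end RegionGraph

end TimedGames

theorem mainTheorem9 {L₁ C₁ L₂ C₂ Act : Type*}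
    [Finite L₁] [Finite C₁] [Finite L₂] [Finite C₂] [Finite Act]
    (A₁ : TimedGames.TimedAutomaton L₁ C₁ Act) (A₂ : TimedGames.TimedAutomaton L₂ C₂ Act)
    (p : A₁.State) (q : A₂.State) :
    (∃ Z : TimedGames.ZoneGraph L₁ C₁, Z.IsZoneValuationGraph A₁ p ∧ Z.IsMinimal A₁ p) ∧
    (∃ Z : TimedGames.ZoneGraph L₂ C₂, Z.IsZoneValuationGraph A₂ q ∧ Z.IsMinimal A₂ q) ∧
    ∀ (Z₁ : TimedGames.ZoneGraph L₁ C₁) (Z₂ : TimedGames.ZoneGraph L₂ C₂),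
      Z₁.IsZoneValuationGraph A₁ p → Z₂.IsZoneValuationGraph A₂ q →
      (TimedGames.DefenderWins 0 ⊤ (Z₁.Trans A₁ p) (Z₂.Trans A₂ q) (Z₁.root, Z₂.root) ↔
        TimedGames.TimeAbstractedSimulationEquivalent A₁ A₂ p q) :=
  ⟨TimedGames.exists_isMinimal_zoneValuationGraph A₁ p,
    TimedGames.exists_isMinimal_zoneValuationGraph A₂ q,
    fun _ _ h₁ h₂ => TimedGames.defenderWins_zero_top_iff h₁ h₂⟩
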